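/- Graphs are finite and simple. A subgraph is obtained by deleting vertices and edges, and unlabeled graphs are isomorphism classes of graphs. For a graph $G$ and an integer $k\ge 1$, let $s_k(G)$ be the number of unlabeled $k$-vertex (not necessarily induced) subgraphs of $G$. For real $d\ge 0$, let $\mathcal S_d$ be the class of all graphs $G$ such that, for every integer $k$ with $1000^{10(d+1)}\le k\le |V(G)|$, every $k$-vertex subgraph of $G$ has at most $k-1+k/\ln k$ edges. An $n$-vertex graph $G$ is called monotone $(c,\mathcal S_d,\ln^2)$-tiny if (1) for every integer $k$ with $1\le k\le (\ln n)^2$, every $k$-vertex subgraph of $G$ is in $\mathcal S_d$; and (2) $s_k(G)\le c^k$ for every integer $k$ with $(\ln n)^2<k\le n$. Let $G(n,m)$ denote the uniform distribution on the graphs with vertex set $\{1,\dots,n\}$ and exactly $m$ edges. **Theorem.** For every real $d\ge 0$ there is a constant $c=c(d)>0$ such that for every integer $n\ge 1$ with $\lceil d(n-1)/2\rceil\le\binom n2$ (so that the distribution exists), if $G_n\sim G(n,\lceil d(n-1)/2\rceil)$, then $$\Pr\big[G_n \text{ is not monotone } (c,\mathcal S_d,\ln^2)\text{-tiny}\big]\le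 200\sqrt{\frac dn},$$ and the inequality is strict if $d>0$. -/

import Mathlib

/-- Two graphs on `k` labeled vertices are identified when they are isomorphic. -/
def graphIsoSetoid (k : ℕ) : Setoid (SimpleGraph (Fin k)) where
  r G H := Nonempty (G ≃g H)
  iseqv :=
    { refl := fun _ => ⟨SimpleGraph.Iso.refl⟩
      symm := fun ⟨e⟩ => ⟨e.symm⟩
      trans := fun ⟨e⟩ ⟨f⟩ => ⟨f.comp e⟩ }

/-- Unlabeled `k`-vertex graphs, i.e. isomorphism classes of `k`-vertex graphs. -/
def UnlabeledGraph (k : ℕ) : Type := Quotient (graphIsoSetoid k)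

/-- The unlabeled graph underlying a labeled graph. -/
def unlabel {k : ℕ} (G : SimpleGraph (Fin k)) : UnlabeledGraph k :=
  Quotient.mk (graphIsoSetoid k) G

/-- A class of finite unlabeled graphs, given by its `k`-vertex members for each `k`. -/
def GraphClass : Type := ∀ k : ℕ, Set (UnlabeledGraph k)

/-- The set of unlabeled `k`-vertex (not necessarily induced) subgraphs of `G`. -/
def unlabeledSubgraphs {n : ℕ} (G : SimpleGraph (Fin n)) (k : ℕ) : Set (UnlabeledGraph k) :=
  {U | ∃ (H : G.Subgraph) (K : SimpleGraph (Fin k)), Nonempty (H.coe ≃g K) ∧ unlabel K = U}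

/-- `s_k(G)`: the number of unlabeled `k`-vertex subgraphs of `G`. -/
noncomputable def numUnlabeledSubgraphs {n : ℕ} (G : SimpleGraph (Fin n)) (k : ℕ) : ℕ :=
  (unlabeledSubgraphs G k).ncard

/-- The class `𝒮_d`: all graphs such that, for every integer `j ≥ 1000 ^ (10 (d + 1))` that is at
most the number of vertices, every `j`-vertex subgraph has at most `j - 1 + j / ln j` edges. -/
def sparseClass (d : ℝ) : GraphClass := fun k =>
  {U | ∀ G : SimpleGraph (Fin k), unlabel G = U →
    ∀ j : ℕ, (1000 : ℝ) ^ (10 * (d + 1)) ≤ (j : ℝ) → j ≤ k →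
      ∀ H : G.Subgraph, H.verts.ncard = j →
        (H.edgeSet.ncard : ℝ) ≤ (j : ℝ) - 1 + (j : ℝ) / Real.log (j : ℝ)}

/-- An `n`-vertex graph is monotone `(c, 𝒴, t)`-tiny if all its subgraphs on `1 ≤ k ≤ t n` vertices
belong to `𝒴` and it has at most `c ^ k` unlabeled `k`-vertex subgraphs for all `t n < k ≤ n`. -/
def IsMonotoneTiny (c : ℝ) (Y : GraphClass) (t : ℕ → ℝ) {n : ℕ} (G : SimpleGraph (Fin n)) : Prop :=
  (∀ k : ℕ, 1 ≤ k → (k : ℝ) ≤ t n → unlabeledSubgraphs G k ⊆ Y k) ∧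
  (∀ k : ℕ, t n < (k : ℝ) → k ≤ n → (numUnlabeledSubgraphs G k : ℝ) ≤ c ^ k)

/-- The finite set of graphs on the vertex set `Fin n` with exactly `m` edges. -/
noncomputable def graphsWithEdges (n m : ℕ) : Finset (SimpleGraph (Fin n)) :=
  Finset.univ.filter fun G => G.edgeSet.ncard = m

theorem graphsWithEdges_nonempty {n m : ℕ} (h : m ≤ n.choose 2) :
    (graphsWithEdges n m).Nonempty := by
  classical
  have hc : m ≤ (⊤ : SimpleGraph (Fin n)).edgeFinset.card := by
    rw [SimpleGraph.card_edgeFinset_top_eq_card_choose_two, Fintype.card_fin]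
    exact h
  obtain ⟨s, hs, hm⟩ := Finset.exists_subset_card_eq hc
  refine ⟨SimpleGraph.fromEdgeSet (s : Set (Sym2 (Fin n))), ?_⟩
  have he : (SimpleGraph.fromEdgeSet (s : Set (Sym2 (Fin n)))).edgeSet = s := by
    rw [SimpleGraph.edgeSet_fromEdgeSet, sdiff_eq_left, Set.disjoint_left]
    intro e h1 h2
    have h3 := SimpleGraph.mem_edgeFinset.1 (hs (Finset.mem_coe.1 h1))
    exact SimpleGraph.not_isDiag_of_mem_edgeSet _ h3 h2
  simp only [graphsWithEdges, Finset.mem_filter, Finset.mem_univ, true_and]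
  rw [he, Set.ncard_coe_finset, hm]

/-- `G(n, m)`: the uniform distribution on the graphs with vertex set `Fin n` and `m` edges
(which exist exactly when `m ≤ n.choose 2`). -/
noncomputable def gnm (n m : ℕ) (h : m ≤ n.choose 2) : PMF (SimpleGraph (Fin n)) :=
  PMF.uniformOfFinset (graphsWithEdges n m) (graphsWithEdges_nonempty h)

/-- The function `ln²` on the natural numbers. -/
noncomputable def lnSq (n : ℕ) : ℝ := Real.log (n : ℝ) ^ 2

/-! A dense pair is a set of `j` vertices together with at least `e` edges inside it. The proof
combines a deterministic encoding with a first moment bound.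

Encoding: removing vertices with at most one remaining neighbour, as long as there are any, leaves a
core of minimum degree at least 2, which has at least as many edges as vertices and so is a dense
pair with `e = j`. Each removed vertex has at most one parent. Ordered suitably, the parent map is
monotone, so it costs only exponentially many choices; `numUnlabeledSubgraphs_le` bounds the number
of `k`-vertex subgraphs by `16 ^ k` times the number of possible cores. Cores on at most `ln n`
vertices are few for trivial reasons once `k > ln² n`.

First moment: a fixed edge set `F` lies in the random graph with probability at most `p ^ |F|`,
where `p = m / n.choose 2`. When `p ≤ 2d/n`, the expected number of dense pairs is at most `exp
((d+1)j) (j/n)^(e-j)` (`sum_card_densePairs_le`). With `e = j` and `j > ln n`, Markov's inequality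
bounds the number of cores; with `e` just above `j - 1 + j / ln j` and `j ≤ ln² n`, the expectation
is at most `n⁻²`, which gives the sparsity condition. A union bound over `j ≤ n` gives failure
probability at most `2/n`. If `m ≥ 2` then `d(n-1) > 2`, so `p ≤ 2d/n` and `2/n < 200√(d/n)`; if `m
≤ 1` no graph fails. -/

/-! ### Dense pairs and their expected number -/

open Classical in
/-- Pairs `(S, F)` of a `j`-element vertex set `S` and a set `F` of at least `e` edges of `G`
inside `S`. -/
noncomputable def densePairs {n : ℕ} (G : SimpleGraph (Fin n)) (j e : ℕ) :
    Finset (Finset (Fin n) × Finset (Sym2 (Fin n))) :=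
  Finset.univ.filter fun q =>
    q.1.card = j ∧ (∀ x ∈ q.2, x ∈ G.edgeSet) ∧ q.2 ⊆ q.1.sym2 ∧ e ≤ q.2.card

theorem mem_densePairs {n : ℕ} {G : SimpleGraph (Fin n)} {j e : ℕ}
    {q : Finset (Fin n) × Finset (Sym2 (Fin n))} :
    q ∈ densePairs G j e ↔
      q.1.card = j ∧ (∀ x ∈ q.2, x ∈ G.edgeSet) ∧ q.2 ⊆ q.1.sym2 ∧ e ≤ q.2.card := by
  simp [densePairs]

/-- The ratio of the binomials is a product of factors `(m-i)/(N-i)`, each at most `m/N`. This makes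
edges of a uniform `m`-edge graph behave no worse than independent ones. -/
theorem choose_sub_mul_pow_le (N m f : ℕ) (hf : f ≤ m) (hm : m ≤ N) :
    (N - f).choose (m - f) * N ^ f ≤ m ^ f * N.choose m := by
  induction f generalizing N m with
  | zero => simp
  | succ f ih =>
    obtain ⟨m, rfl⟩ : ∃ m', m = m' + 1 := ⟨m - 1, by omega⟩
    obtain ⟨N, rfl⟩ : ∃ N', N = N' + 1 := ⟨N - 1, by omega⟩
    have h := ih N m (by omega) (by omega)
    have h1 := Nat.add_one_mul_choose_eq N m
    simp only [Nat.add_sub_add_right]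
    rcases Nat.eq_zero_or_pos N with rfl | hN
    · obtain rfl : m = 0 := by omega
      obtain rfl : f = 0 := by omega
      simp
    have hmN : (m * (N + 1)) ^ f ≤ ((m + 1) * N) ^ f := Nat.pow_le_pow_left (by nlinarith) f
    rw [mul_pow, mul_pow] at hmN
    refine Nat.le_of_mul_le_mul_right (c := N ^ f) ?_ (by positivity)
    calc (N - f).choose (m - f) * (N + 1) ^ (f + 1) * N ^ f
        = ((N - f).choose (m - f) * N ^ f) * (N + 1) ^ (f + 1) := by ring
      _ ≤ (m ^ f * N.choose m) * (N + 1) ^ (f + 1) := Nat.mul_le_mul_right _ h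
      _ = (m ^ f * (N + 1) ^ f) * ((N + 1) * N.choose m) := by ring
      _ ≤ ((m + 1) ^ f * N ^ f) * ((N + 1) * N.choose m) := Nat.mul_le_mul_right _ hmN
      _ = (m + 1) ^ (f + 1) * (N + 1).choose (m + 1) * N ^ f := by rw [h1]; ring

theorem card_powersetCard_superset_mul_le {α : Type*} [DecidableEq α] (E F : Finset α) (m : ℕ)
    (hm : m ≤ E.card) (hF : F ⊆ E) :
    ((E.powersetCard m).filter (F ⊆ ·)).card * E.card ^ F.card ≤
      m ^ F.card * (E.powersetCard m).card := by
  by_cases hf : F.card ≤ m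
  · refine le_trans (Nat.mul_le_mul_right _ ?_)
      (by simpa using choose_sub_mul_pow_le E.card m F.card hf hm)
    rw [← Finset.card_sdiff_of_subset hF, ← Finset.card_powersetCard]
    refine Finset.card_le_card_of_injOn (· \ F) ?_ ?_
    · intro T hT
      simp only [Finset.coe_filter, Finset.mem_powersetCard, Set.mem_ofPred_eq] at hT
      simp only [Finset.mem_coe, Finset.mem_powersetCard]
      exact ⟨Finset.sdiff_subset_sdiff hT.1.1 le_rfl, by
        rw [Finset.card_sdiff_of_subset hT.2, hT.1.2]⟩
    · intro T hT T' hT' h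
      simp only [Finset.coe_filter, Finset.mem_powersetCard, Set.mem_ofPred_eq] at hT hT'
      rw [← Finset.sdiff_union_of_subset hT.2, ← Finset.sdiff_union_of_subset hT'.2]
      exact congrArg (· ∪ F) h
  · rw [Finset.filter_false_of_mem]
    · simp
    · intro T hT hFT
      rw [Finset.mem_powersetCard] at hT
      exact hf (hT.2 ▸ Finset.card_le_card hFT)

theorem card_graphsWithEdges (n m : ℕ) :
    (graphsWithEdges n m).card = (n.choose 2).choose m := by
  classical
  have hN : (⊤ : SimpleGraph (Fin n)).edgeFinset.card = n.choose 2 := by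
    rw [SimpleGraph.card_edgeFinset_top_eq_card_choose_two, Fintype.card_fin]
  rw [← hN, ← Finset.card_powersetCard]
  refine Finset.card_bij' (fun G _ => G.edgeFinset)
    (fun s _ => SimpleGraph.fromEdgeSet (s : Set (Sym2 (Fin n)))) ?_ ?_ ?_ ?_
  · intro G hG
    simp only [graphsWithEdges, Finset.mem_filter, Finset.mem_univ, true_and] at hG
    rw [Finset.mem_powersetCard]
    refine ⟨SimpleGraph.edgeFinset_mono le_top, ?_⟩
    rw [← hG, ← SimpleGraph.coe_edgeFinset, Set.ncard_coe_finset]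
  · intro s hs
    rw [Finset.mem_powersetCard] at hs
    simp only [graphsWithEdges, Finset.mem_filter, Finset.mem_univ, true_and]
    rw [SimpleGraph.edgeSet_fromEdgeSet, sdiff_eq_left.2, Set.ncard_coe_finset, hs.2]
    rw [Set.disjoint_left]
    intro e h1 h2
    exact SimpleGraph.not_isDiag_of_mem_edgeSet _ (SimpleGraph.mem_edgeFinset.1 (hs.1 h1)) h2
  · intro G hG
    simp
  · intro s hs
    rw [Finset.mem_powersetCard] at hs
    ext e
    simp only [SimpleGraph.mem_edgeFinset, SimpleGraph.edgeSet_fromEdgeSet, Set.mem_sdiff,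
      Finset.mem_coe, and_iff_left_iff_imp]
    intro he
    exact SimpleGraph.not_isDiag_of_mem_edgeSet _ (SimpleGraph.mem_edgeFinset.1 (hs.1 he))

open Classical in
theorem card_graphsWithEdges_superset_mul_le {n m : ℕ} (hm : m ≤ n.choose 2)
    (F : Finset (Sym2 (Fin n))) :
    ((graphsWithEdges n m).filter fun G => ∀ x ∈ F, x ∈ G.edgeSet).card *
      (n.choose 2) ^ F.card ≤ m ^ F.card * (graphsWithEdges n m).card := by
  have hN : (⊤ : SimpleGraph (Fin n)).edgeFinset.card = n.choose 2 := by
    rw [SimpleGraph.card_edgeFinset_top_eq_card_choose_two, Fintype.card_fin]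
  by_cases hF : F ⊆ (⊤ : SimpleGraph (Fin n)).edgeFinset
  · have h := card_powersetCard_superset_mul_le _ F m (hN ▸ hm) hF
    rw [Finset.card_powersetCard, hN, ← card_graphsWithEdges] at h
    refine le_trans (Nat.mul_le_mul_right _ ?_) h
    refine Finset.card_le_card_of_injOn (fun G => G.edgeFinset) ?_ ?_
    · intro G hG
      simp only [graphsWithEdges, Finset.coe_filter, Finset.mem_filter, Finset.mem_univ,
        true_and, Set.mem_ofPred_eq] at hG
      simp only [Finset.coe_filter, Finset.mem_powersetCard, Set.mem_ofPred_eq]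
      refine ⟨⟨SimpleGraph.edgeFinset_mono le_top, ?_⟩, ?_⟩
      · rw [← hG.1, ← SimpleGraph.coe_edgeFinset, Set.ncard_coe_finset]
      · intro x hx
        exact SimpleGraph.mem_edgeFinset.2 (hG.2 x hx)
    · intro G _ G' _ h
      simpa using h
  · rw [Finset.filter_false_of_mem]
    · simp
    · intro G _ hG
      refine hF fun x hx => ?_
      exact SimpleGraph.edgeFinset_mono le_top (SimpleGraph.mem_edgeFinset.2 (hG x hx))

open Classical in
/-- Chernoff-type bound for the generating function of the large subsets of `E`. -/
theorem sum_pow_card_le {α : Type*} (E : Finset α) (e : ℕ) (p t : ℝ) (hp : 0 ≤ p) (ht : 1 ≤ t) :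
    ∑ F ∈ E.powerset.filter (fun F => e ≤ F.card), p ^ F.card ≤
      t⁻¹ ^ e * Real.exp (p * t * E.card) := by
  have ht0 : 0 < t := by linarith
  -- Exponential tilting: `t ^ (|F| - e) ≥ 1` on the sets that are counted, so each term may be
  -- multiplied by it.
  calc ∑ F ∈ E.powerset.filter (fun F => e ≤ F.card), p ^ F.card
      ≤ ∑ F ∈ E.powerset.filter (fun F => e ≤ F.card), t⁻¹ ^ e * (p * t) ^ F.card := by
        refine Finset.sum_le_sum fun F hF => ?_
        rw [Finset.mem_filter] at hF
        have h1 : 1 ≤ t⁻¹ ^ e * t ^ F.card := by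
          rw [inv_pow, ← div_eq_inv_mul, one_le_div (by positivity)]
          exact pow_le_pow_right₀ ht hF.2
        rw [mul_pow]
        nlinarith [pow_nonneg hp F.card]
    _ ≤ ∑ F ∈ E.powerset, t⁻¹ ^ e * (p * t) ^ F.card :=
        Finset.sum_le_sum_of_subset_of_nonneg (Finset.filter_subset _ _)
          fun _ _ _ => by positivity
    _ = t⁻¹ ^ e * (p * t + 1) ^ E.card := by
        rw [← Finset.mul_sum, ← Finset.sum_pow_mul_eq_add_pow]; simp
    _ ≤ t⁻¹ ^ e * Real.exp (p * t * E.card) := by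
        refine mul_le_mul_of_nonneg_left ?_ (by positivity)
        rw [mul_comm _ (E.card : ℝ), Real.exp_nat_mul]
        exact pow_le_pow_left₀ (by positivity) (Real.add_one_le_exp _) _

theorem choose_le_exp_mul_pow (n j : ℕ) (hj : 0 < j) :
    (n.choose j : ℝ) ≤ Real.exp j * ((n : ℝ) / j) ^ j := by
  have h1 : (n.choose j : ℝ) ≤ (n : ℝ) ^ j / j.factorial := Nat.choose_le_pow_div j n
  have h2 : (j : ℝ) ^ j / j.factorial ≤ Real.exp j := Real.pow_div_factorial_le_exp _ (by positivity) j
  have hj' : (0 : ℝ) < j := by exact_mod_cast hj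
  calc (n.choose j : ℝ) ≤ (n : ℝ) ^ j / j.factorial := h1
    _ = (j : ℝ) ^ j / j.factorial * ((n : ℝ) / j) ^ j := by
        rw [div_pow]; field_simp
    _ ≤ _ := mul_le_mul_of_nonneg_right h2 (by positivity)

open Classical in
/-- The average number of dense pairs over all graphs with `m` edges. -/
theorem sum_card_densePairs_le {n m : ℕ} {d : ℝ} (hd : 0 ≤ d) (hN0 : 0 < n.choose 2)
    (hm : m ≤ n.choose 2) (hp : (m : ℝ) / (n.choose 2 : ℕ) ≤ 2 * d / n) (j e : ℕ) (hj : 0 < j) (hjn : j ≤ n)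
    (hje : j ≤ e) :
    ∑ G ∈ graphsWithEdges n m, ((densePairs G j e).card : ℝ) ≤
      (graphsWithEdges n m).card * (Real.exp ((d + 1) * j) * ((j : ℝ) / n) ^ (e - j)) := by
  set N := n.choose 2 with hN
  set p : ℝ := (m : ℝ) / N with hpdef
  have hp0 : 0 ≤ p := by positivity
  have hj' : (0 : ℝ) < j := by exact_mod_cast hj
  have hn' : (0 : ℝ) < n := by exact_mod_cast hj.trans_le hjn
  set W : ℝ := ((graphsWithEdges n m).card : ℝ)
  have hW : 0 ≤ W := by positivity
  let off (S : Finset (Fin n)) := S.sym2.filter fun x => ¬ x.IsDiag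
  have hsup (F : Finset (Sym2 (Fin n))) :
      (((graphsWithEdges n m).filter fun G => ∀ x ∈ F, x ∈ G.edgeSet).card : ℝ) ≤
        W * p ^ F.card := by
    have h := card_graphsWithEdges_superset_mul_le hm F
    have h' : (((graphsWithEdges n m).filter fun G => ∀ x ∈ F, x ∈ G.edgeSet).card : ℝ) *
      (N : ℝ) ^ F.card ≤ (m : ℝ) ^ F.card * W := by
      simp only [W]; exact_mod_cast h
    rw [hpdef, div_pow, mul_div_assoc', le_div_iff₀ (by positivity)]
    linarith
  have hoff (S : Finset (Fin n)) (hS : S.card = j) : ((off S).card : ℝ) ≤ (j : ℝ) ^ 2 / 2 := by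
    have h : off S ⊆ S.offDiag.image (Function.uncurry Sym2.mk) := by
      intro x hx
      induction x with | _ a b
      simp only [off, Finset.mem_filter, Finset.mk_mem_sym2_iff, Sym2.mk_isDiag_iff] at hx
      exact Finset.mem_image.2 ⟨(a, b), Finset.mem_offDiag.2 ⟨hx.1.1, hx.1.2, hx.2⟩, rfl⟩
    have h1 := Finset.card_le_card h
    rw [Sym2.card_image_offDiag, hS] at h1
    have h2 : ((j.choose 2 : ℕ) : ℝ) ≤ (j : ℝ) ^ 2 / (Nat.factorial 2 : ℕ) :=
      Nat.choose_le_pow_div 2 j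
    have h3 : ((off S).card : ℝ) ≤ (j.choose 2 : ℕ) := by exact_mod_cast h1
    simpa using h3.trans h2
  calc ∑ G ∈ graphsWithEdges n m, ((densePairs G j e).card : ℝ)
      ≤ ∑ G ∈ graphsWithEdges n m, ∑ S ∈ Finset.univ.powersetCard j,
          ∑ F ∈ (off S).powerset.filter (fun F => e ≤ F.card),
            if ∀ x ∈ F, x ∈ G.edgeSet then (1 : ℝ) else 0 := by
        refine Finset.sum_le_sum fun G _ => ?_
        simp only [Finset.sum_boole]
        rw [← Nat.cast_sum, Nat.cast_le, ← Finset.card_sigma]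
        refine Finset.card_le_card_of_injOn (fun q => ⟨q.1, q.2⟩) ?_ ?_
        · intro q hq
          obtain ⟨h1, h2, h3, h4⟩ := mem_densePairs.1 hq
          simp only [off, Finset.coe_sigma, Set.mem_sigma_iff, Finset.mem_coe, Finset.mem_filter,
            Finset.mem_powersetCard, Finset.mem_powerset]
          refine ⟨⟨Finset.subset_univ _, h1⟩, ⟨fun x hx => ?_, h4⟩, h2⟩
          exact Finset.mem_filter.2 ⟨h3 hx, G.not_isDiag_of_mem_edgeSet (h2 x hx)⟩
        · rintro ⟨a, b⟩ _ ⟨a', b'⟩ _ h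
          simpa using h
    _ = ∑ S ∈ Finset.univ.powersetCard j, ∑ F ∈ (off S).powerset.filter (fun F => e ≤ F.card),
          (((graphsWithEdges n m).filter fun G => ∀ x ∈ F, x ∈ G.edgeSet).card : ℝ) := by
        rw [Finset.sum_comm]
        refine Finset.sum_congr rfl fun S _ => ?_
        rw [Finset.sum_comm]
        refine Finset.sum_congr rfl fun F _ => ?_
        simp
    _ ≤ ∑ S ∈ (Finset.univ : Finset (Fin n)).powersetCard j,
          W * ((j / n : ℝ) ^ e * Real.exp (d * j)) := by
        refine Finset.sum_le_sum fun S hS => ?_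
        rw [Finset.mem_powersetCard] at hS
        refine (Finset.sum_le_sum fun F _ => hsup F).trans ?_
        rw [← Finset.mul_sum]
        refine mul_le_mul_of_nonneg_left ?_ hW
        -- The tilt `t = n/j` turns `t⁻¹ ^ e` into `(j/n)^e`, while the exponent `p t |off S|` stays
        -- at most `d j`.
        refine (sum_pow_card_le (off S) e p (n / j) hp0 ?_).trans ?_
        · rw [one_le_div hj']; exact_mod_cast hjn
        · rw [inv_div]
          refine mul_le_mul_of_nonneg_left (Real.exp_le_exp.2 ?_) (by positivity)
          calc p * (n / j) * (off S).card ≤ (2 * d / n) * (n / j) * ((j : ℝ) ^ 2 / 2) := by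
                gcongr
                exact hoff S hS.2
            _ = d * j := by field_simp
    _ = W * ((n.choose j : ℝ) * ((j / n : ℝ) ^ e * Real.exp (d * j))) := by
        simp; ring
    _ ≤ W * ((Real.exp j * ((n : ℝ) / j) ^ j) * ((j / n : ℝ) ^ e * Real.exp (d * j))) := by
        gcongr
        exact choose_le_exp_mul_pow n j hj
    _ = _ := by
        obtain ⟨x, rfl⟩ := Nat.exists_eq_add_of_le hje
        rw [Nat.add_sub_cancel_left, pow_add, add_mul, one_mul, Real.exp_add]
        have : ((n : ℝ) / j) ^ j * (j / n : ℝ) ^ j = 1 := by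
          rw [← mul_pow]; field_simp; simp
        linear_combination W * Real.exp j * Real.exp (d * j) * (j / n : ℝ) ^ x * this

/-! ### Encoding subgraphs by a dense core and a monotone parent function -/

/-- Repeatedly deleting vertices with at most one neighbour splits a graph into a core with at
least as many edges as vertices and a forest of parent edges. The vertices are numbered by keys
such that the key of a parent is read off monotonically from the key of its child. -/
theorem exists_core_and_parents {n : ℕ} (L : SimpleGraph (Fin n)) (D : Finset (Fin n)) :
    ∃ (C : Finset (Fin n)) (F : Finset (Sym2 (Fin n))) (par : Fin n → Option (Fin n))
      (key : Fin n → ℕ),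
      C ⊆ D ∧ (∀ x ∈ F, x ∈ L.edgeSet) ∧ F ⊆ C.sym2 ∧ C.card ≤ F.card ∧
      (∀ v ∈ D, ∀ u, par v = some u → u ∈ D ∧ L.Adj v u ∧ key v = (n + 1) * key u + (v + 1)) ∧
      (∀ v ∈ D, par v = none → key v = v + 1) ∧
      (∀ v ∈ C, par v = none) ∧
      (∀ u ∈ D, ∀ v ∈ D, L.Adj u v → s(u, v) ∈ F ∨ par u = some v ∨ par v = some u) := by
  classical
  induction D using Finset.strongInduction with
  | H D ih =>
  by_cases hdeg : ∀ v ∈ D, 2 ≤ (D.filter (L.Adj v)).card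
  · refine ⟨D, D.sym2.filter (· ∈ L.edgeSet), fun _ => none, fun v => v + 1, subset_rfl,
      fun x hx => (Finset.mem_filter.1 hx).2, Finset.filter_subset _ _, ?_, by simp, by simp,
      by simp, ?_⟩
    -- Double counting of incidences: every vertex is on at least two edges, every edge has at most
    -- two ends.
    · have h1 : D.card * 2 ≤ (D.sym2.filter (· ∈ L.edgeSet)).card * 2 := by
        refine Finset.card_mul_le_card_mul (fun v x => v ∈ x) (fun v hv => ?_) (fun x hx => ?_)
        · refine (hdeg v hv).trans ?_
          refine Finset.card_le_card_of_injOn (fun u => s(v, u)) ?_ ?_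
          · intro u hu
            simp only [Finset.coe_filter, Set.mem_ofPred_eq] at hu
            simp [Finset.bipartiteAbove, hu.1, hu.2, hv]
          · intro u _ u' _ h
            exact Sym2.congr_right.1 h
        · induction x with | _ a b
          refine (Finset.card_le_card (t := {a, b}) ?_).trans Finset.card_le_two
          intro v hv
          simp only [Finset.bipartiteBelow, Finset.mem_filter, Sym2.mem_iff] at hv
          simpa using hv.2
      omega
    · intro u hu v hv h
      left
      simp [hu, hv, h]
  · push Not at hdeg
    obtain ⟨w, hw, hw2⟩ := hdeg
    obtain ⟨C, F, par, key, hCD, hFL, hFC, hcard, hsome, hnone, hCn, hadj⟩ :=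
      ih (D.erase w) (Finset.erase_ssubset hw)
    have hwC : w ∉ C := fun h => by simpa using hCD h
    have hCD' : C ⊆ D := hCD.trans (Finset.erase_subset _ _)
    rcases Finset.eq_empty_or_nonempty (D.filter (L.Adj w)) with h0 | ⟨x, hx⟩
    · have hnb : ∀ u ∈ D, ¬ L.Adj w u := fun u hu h => by
        have : u ∈ D.filter (L.Adj w) := Finset.mem_filter.2 ⟨hu, h⟩
        simp [h0] at this
      refine ⟨C, F, Function.update par w none, Function.update key w (w + 1), hCD', hFL, hFC,
        hcard, ?_, ?_, ?_, ?_⟩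
      · intro v hv u hpu
        have hvw : v ≠ w := by rintro rfl; simp at hpu
        rw [Function.update_of_ne hvw] at hpu
        obtain ⟨h1, h2, h3⟩ := hsome v (Finset.mem_erase.2 ⟨hvw, hv⟩) u hpu
        rw [Finset.mem_erase] at h1
        rw [Function.update_of_ne hvw, Function.update_of_ne h1.1]
        exact ⟨h1.2, h2, h3⟩
      · intro v hv hpv
        by_cases hvw : v = w
        · subst hvw; simp
        · rw [Function.update_of_ne hvw] at hpv ⊢
          exact hnone v (Finset.mem_erase.2 ⟨hvw, hv⟩) hpv
      · intro v hv
        rw [Function.update_of_ne (ne_of_mem_of_not_mem hv hwC)]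
        exact hCn v hv
      · intro u hu v hv h
        have huw : u ≠ w := by rintro rfl; exact hnb v hv h
        have hvw : v ≠ w := by rintro rfl; exact hnb u hu h.symm
        rw [Function.update_of_ne huw, Function.update_of_ne hvw]
        exact hadj u (Finset.mem_erase.2 ⟨huw, hu⟩) v (Finset.mem_erase.2 ⟨hvw, hv⟩) h
    · have hx' := Finset.mem_filter.1 hx
      have hxw : x ≠ w := fun h => hx'.2.ne h.symm
      have hnb : ∀ u ∈ D, L.Adj w u → u = x := fun u hu h =>
        Finset.card_le_one.1 (by omega) u (Finset.mem_filter.2 ⟨hu, h⟩) x hx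
      refine ⟨C, F, Function.update par w (some x),
        Function.update key w ((n + 1) * key x + (w + 1)), hCD', hFL, hFC,
        hcard, ?_, ?_, ?_, ?_⟩
      · intro v hv u hpu
        by_cases hvw : v = w
        · subst hvw
          obtain rfl : x = u := by simpa using hpu
          rw [Function.update_self, Function.update_of_ne hxw]
          exact ⟨hx'.1, hx'.2, rfl⟩
        rw [Function.update_of_ne hvw] at hpu
        obtain ⟨h1, h2, h3⟩ := hsome v (Finset.mem_erase.2 ⟨hvw, hv⟩) u hpu
        rw [Finset.mem_erase] at h1
        rw [Function.update_of_ne hvw, Function.update_of_ne h1.1]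
        exact ⟨h1.2, h2, h3⟩
      · intro v hv hpv
        have hvw : v ≠ w := by rintro rfl; simp at hpv
        rw [Function.update_of_ne hvw] at hpv ⊢
        exact hnone v (Finset.mem_erase.2 ⟨hvw, hv⟩) hpv
      · intro v hv
        rw [Function.update_of_ne (ne_of_mem_of_not_mem hv hwC)]
        exact hCn v hv
      · intro u hu v hv h
        by_cases huw : u = w
        · subst huw
          right; left
          rw [Function.update_self, hnb v hv h]
        by_cases hvw : v = w
        · subst hvw
          right; right
          rw [Function.update_self, hnb u hu h.symm]
        rw [Function.update_of_ne huw, Function.update_of_ne hvw]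
        exact hadj u (Finset.mem_erase.2 ⟨huw, hu⟩) v (Finset.mem_erase.2 ⟨hvw, hv⟩) h

/-- The graph `K` is described by the positions `P` of its core, the embedded core `(S, F)`, the
set `Q` of vertices with a parent, and the set `R` of sums of a vertex and its parent. -/
def IsEncodedBy {n k : ℕ} (K : SimpleGraph (Fin k)) (P : Finset (Fin k))
    (S : Finset (Fin n)) (F : Finset (Sym2 (Fin n))) (Q : Finset (Fin k)) (R : Finset ℕ) : Prop :=
  ∃ (e : Fin k → Fin n) (p : Fin k → ℕ),
    StrictMonoOn e P ∧ e '' P = S ∧ StrictMonoOn (fun i => p i + i) Q ∧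
    (fun i => p i + (i : ℕ)) '' Q = R ∧
    ∀ i j, K.Adj i j ↔ (i ∈ P ∧ j ∈ P ∧ s(e i, e j) ∈ F) ∨ (i ∈ Q ∧ p i = j) ∨ (j ∈ Q ∧ p j = i)

/-- Both functions list the common image in increasing order. This is what allows maps to be decoded
from sets. -/
theorem StrictMonoOn.eqOn_of_image_eq {α β : Type*} [LinearOrder α] [WellFoundedLT α]
    [PartialOrder β] {f g : α → β} {s : Set α} (hf : StrictMonoOn f s) (hg : StrictMonoOn g s)
    (h : f '' s = g '' s) : Set.EqOn f g s := by
  have h1 : s.domRestrict f = s.domRestrict g := by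
    refine (StrictMono.range_inj hf.domRestrict hg.domRestrict).1 ?_
    rw [Set.range_domRestrict, Set.range_domRestrict, h]
  intro x hx
  exact congrFun h1 ⟨x, hx⟩

theorem IsEncodedBy.unique {n k : ℕ} {K K' : SimpleGraph (Fin k)} {P : Finset (Fin k)}
    {S : Finset (Fin n)} {F : Finset (Sym2 (Fin n))} {Q : Finset (Fin k)} {R : Finset ℕ}
    (h : IsEncodedBy K P S F Q R) (h' : IsEncodedBy K' P S F Q R) : K = K' := by
  obtain ⟨e, p, he, heS, hp, hpR, hK⟩ := h
  obtain ⟨e', p', he', heS', hp', hpR', hK'⟩ := h'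
  have h1 : Set.EqOn e e' P := he.eqOn_of_image_eq he' (heS.trans heS'.symm)
  have h2 : Set.EqOn p p' Q := fun i hi => by
    have := hp.eqOn_of_image_eq hp' (hpR.trans hpR'.symm) hi
    simpa using this
  ext i j
  rw [hK, hK']
  refine or_congr ?_ (or_congr ?_ ?_)
  · refine and_congr_right fun hi => and_congr_right fun hj => ?_
    rw [h1 hi, h1 hj]
  · refine and_congr_right fun hi => ?_
    rw [h2 hi]
  · refine and_congr_right fun hj => ?_
    rw [h2 hj]

/-- Numbering the vertices by increasing key makes the parent position `p` weakly monotone on `Q`.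
Adding the identity makes it strictly monotone, so its image, a set of numbers below `2k`,
determines it. -/
theorem exists_isEncodedBy {n k : ℕ} {G : SimpleGraph (Fin n)} {U : UnlabeledGraph k}
    (hU : U ∈ unlabeledSubgraphs G k) :
    ∃ (K : SimpleGraph (Fin k)) (P : Finset (Fin k)) (S : Finset (Fin n))
      (F : Finset (Sym2 (Fin n))) (Q : Finset (Fin k)) (R : Finset ℕ),
      unlabel K = U ∧ IsEncodedBy K P S F Q R ∧
      S.card ≤ k ∧ (S, F) ∈ densePairs G S.card S.card ∧ R ⊆ Finset.range (2 * k) := by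
  classical
  obtain ⟨H, K₀, ⟨φ⟩, hK₀⟩ := hU
  set D : Finset (Fin n) := H.verts.toFinset with hD
  have hDmem (v : Fin n) : v ∈ D ↔ v ∈ H.verts := by simp [hD]
  have hDk : D.card = k := by
    rw [hD, Set.toFinset_card, Fintype.card_congr φ.toEquiv, Fintype.card_fin]
  obtain ⟨C, F, par, key, hCD, hFL, hFC, hcard, hsome, hnone, hCn, hadj⟩ :=
    exists_core_and_parents H.spanningCoe D
  -- In base `n + 1`, the digits of a key are the labels `v + 1` along the path from a root. The
  -- last digit recovers the vertex, and deleting it gives the parent's key.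
  have hmod (v) (hv : v ∈ D) : key v % (n + 1) = v + 1 := by
    have hlt : (v : ℕ) + 1 < n + 1 := by omega
    cases h : par v with
    | none => rw [hnone v hv h, Nat.mod_eq_of_lt hlt]
    | some u => rw [(hsome v hv u h).2.2, Nat.mul_add_mod, Nat.mod_eq_of_lt hlt]
  have hdiv (v) (hv : v ∈ D) (u) (h : par v = some u) : key v / (n + 1) = key u := by
    have hlt : (v : ℕ) + 1 < n + 1 := by omega
    rw [(hsome v hv u h).2.2, Nat.mul_add_div (by omega), Nat.div_eq_of_lt hlt, add_zero]
  have hinj : Set.InjOn key D := fun v hv u hu h => by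
    have h1 := hmod v hv
    rw [h, hmod u hu] at h1
    exact Fin.ext (by omega)
  have hIk : (D.image key).card = k := by rw [Finset.card_image_of_injOn hinj, hDk]
  let f := (D.image key).orderEmbOfFin hIk
  have hf (i : Fin k) : ∃ v ∈ D, key v = f i :=
    Finset.mem_image.1 (Finset.orderEmbOfFin_mem _ hIk i)
  choose e heD hekey using hf
  have hlt (i j : Fin k) : key (e i) < key (e j) ↔ i < j := by
    rw [hekey, hekey]; exact f.lt_iff_lt
  have hle (i j : Fin k) : key (e i) ≤ key (e j) ↔ i ≤ j := by
    rw [hekey, hekey]; exact f.le_iff_le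
  have heinj : Function.Injective e := fun i j h =>
    le_antisymm ((hle i j).1 (by rw [h])) ((hle j i).1 (by rw [h]))
  have hesurj (v) (hv : v ∈ D) : ∃ i, e i = v := by
    have h1 : key v ∈ Set.range f := by
      rw [Finset.range_orderEmbOfFin]
      exact Finset.mem_coe.2 (Finset.mem_image_of_mem _ hv)
    obtain ⟨i, hi⟩ := h1
    exact ⟨i, hinj (heD i) hv ((hekey i).trans hi)⟩
  let K : SimpleGraph (Fin k) := H.spanningCoe.comap e
  let ψ : K ≃g H.coe :=
    { toEquiv := Equiv.ofBijective (fun i => ⟨e i, (hDmem _).1 (heD i)⟩)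
        ⟨fun i j h => heinj (by simpa using h), fun v => by
          obtain ⟨i, hi⟩ := hesurj v.1 ((hDmem _).2 v.2)
          exact ⟨i, Subtype.ext hi⟩⟩
      map_rel_iff' := by
        intro i j
        rfl }
  let P : Finset (Fin k) := Finset.univ.filter fun i => e i ∈ C
  let Q : Finset (Fin k) := Finset.univ.filter fun i => ∃ j, par (e i) = some (e j)
  have hQ (i) : ∃ m : ℕ, ∀ j, par (e i) = some (e j) → m = (j : ℕ) := by
    by_cases h : ∃ j, par (e i) = some (e j)
    · obtain ⟨j, hj⟩ := h
      refine ⟨j, fun j' hj' => ?_⟩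
      rw [hj, Option.some_inj] at hj'
      rw [heinj hj']
    · exact ⟨0, fun j hj => absurd ⟨j, hj⟩ h⟩
  choose p hp using hQ
  have hpar (i j : Fin k) : (i ∈ Q ∧ p i = j) ↔ par (e i) = some (e j) := by
    constructor
    · rintro ⟨hi, hj⟩
      obtain ⟨j', hj'⟩ := (Finset.mem_filter.1 hi).2
      have h1 := hp i j' hj'
      obtain rfl : j = j' := Fin.ext (by omega)
      exact hj'
    · intro h
      exact ⟨Finset.mem_filter.2 ⟨Finset.mem_univ _, j, h⟩, hp i j h⟩
  -- Core vertices have no parent, so on the core the key order is the order of `Fin n`.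
  have hkeyC (v) (hv : v ∈ C) : key v = v + 1 := hnone v (hCD hv) (hCn v hv)
  refine ⟨K, P, C, F, Q, Q.image fun i => p i + (i : ℕ), ?_, ⟨e, p, ?_, ?_, ?_, ?_, ?_⟩, ?_, ?_, ?_⟩
  · rw [← hK₀]
    exact Quotient.sound ⟨ψ.trans φ⟩
  · intro i hi j hj hij
    have h1 := (hlt i j).2 hij
    rw [hkeyC _ (Finset.mem_filter.1 hi).2, hkeyC _ (Finset.mem_filter.1 hj).2] at h1
    exact Fin.lt_def.2 (by omega)
  · ext v
    constructor
    · rintro ⟨i, hi, rfl⟩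
      exact (Finset.mem_filter.1 hi).2
    · intro hv
      obtain ⟨i, rfl⟩ := hesurj v (hCD hv)
      exact ⟨i, Finset.mem_filter.2 ⟨Finset.mem_univ _, hv⟩, rfl⟩
  · intro i hi j hj hij
    obtain ⟨i', hi'⟩ := (Finset.mem_filter.1 hi).2
    obtain ⟨j', hj'⟩ := (Finset.mem_filter.1 hj).2
    have h1 : key (e i') ≤ key (e j') := by
      rw [← hdiv _ (heD i) _ hi', ← hdiv _ (heD j) _ hj']
      exact Nat.div_le_div_right ((hle i j).2 hij.le)
    have h2 : (i' : ℕ) ≤ j' := (hle i' j').1 h1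
    have h3 : (i : ℕ) < j := hij
    simp only [hp i i' hi', hp j j' hj']
    omega
  · simp
  · intro i j
    rw [hpar, hpar]
    constructor
    · intro h
      rcases hadj (e i) (heD i) (e j) (heD j) h with h | h | h
      · have h1 := Finset.mk_mem_sym2_iff.1 (hFC h)
        exact Or.inl ⟨Finset.mem_filter.2 ⟨Finset.mem_univ _, h1.1⟩,
          Finset.mem_filter.2 ⟨Finset.mem_univ _, h1.2⟩, h⟩
      · exact Or.inr (Or.inl h)
      · exact Or.inr (Or.inr h)
    · rintro (⟨_, _, h⟩ | h | h)
      · exact hFL _ h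
      · exact (hsome _ (heD i) _ h).2.1
      · exact (hsome _ (heD j) _ h).2.1.symm
  · rw [← hDk]; exact Finset.card_le_card hCD
  · refine mem_densePairs.2 ⟨rfl, fun x hx => ?_, hFC, hcard⟩
    exact SimpleGraph.edgeSet_mono H.spanningCoe_le (hFL x hx)
  · intro x hx
    obtain ⟨i, hi, rfl⟩ := Finset.mem_image.1 hx
    obtain ⟨j, hj⟩ := (Finset.mem_filter.1 hi).2
    rw [hp i j hj, Finset.mem_range]
    omega

/-- The number of unlabeled subgraphs is controlled by the numbers of dense pairs. -/
theorem numUnlabeledSubgraphs_le {n : ℕ} (G : SimpleGraph (Fin n)) (k : ℕ) :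
    numUnlabeledSubgraphs G k ≤
      16 ^ k * ∑ i ∈ Finset.range (k + 1), (densePairs G i i).card := by
  classical
  choose! K P S F Q R hK henc hS hSF hR using
    fun U (hU : U ∈ unlabeledSubgraphs G k) => exists_isEncodedBy hU
  let T : Finset (Finset (Fin k) × (Finset (Fin n) × Finset (Sym2 (Fin n))) ×
      Finset (Fin k) × Finset ℕ) :=
    Finset.univ ×ˢ ((Finset.range (k + 1)).biUnion fun i => densePairs G i i) ×ˢ
      Finset.univ ×ˢ (Finset.range (2 * k)).powerset
  have h1 : numUnlabeledSubgraphs G k ≤ (↑T : Set (Finset (Fin k) × (Finset (Fin n) ×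
      Finset (Sym2 (Fin n))) × Finset (Fin k) × Finset ℕ)).ncard := by
    refine Set.ncard_le_ncard_of_injOn (fun U => (P U, (S U, F U), Q U, R U)) ?_ ?_
      (Finset.finite_toSet T)
    · intro U hU
      simp only [T, Finset.mem_coe, Finset.mem_product, Finset.mem_univ, true_and,
        Finset.mem_biUnion, Finset.mem_range, Finset.mem_powerset]
      exact ⟨⟨_, Nat.lt_succ_of_le (hS U hU), hSF U hU⟩, hR U hU⟩
    · intro U hU U' hU' h
      simp only [Prod.mk.injEq] at h
      obtain ⟨hP, ⟨hS', hF⟩, hQ, hR'⟩ := h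
      have h2 := henc U hU
      rw [hP, hS', hF, hQ, hR'] at h2
      rw [← hK U hU, ← hK U' hU', h2.unique (henc U' hU')]
  rw [Set.ncard_coe_finset] at h1
  refine h1.trans ?_
  -- The factors count the choices of `P`, `Q` and `R`.
  have h16 : 16 ^ k = 2 ^ k * (2 ^ k * 2 ^ (2 * k)) := by
    rw [pow_mul, ← mul_pow, ← mul_pow]; norm_num
  simp only [T, Finset.card_product, Finset.card_univ, Fintype.card_finset, Fintype.card_fin,
    Finset.card_powerset, Finset.card_range]
  calc _ ≤ 2 ^ k * ((∑ i ∈ Finset.range (k + 1), (densePairs G i i).card) *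
        (2 ^ k * 2 ^ (2 * k))) := by
        gcongr
        exact Finset.card_biUnion_le
    _ = _ := by rw [h16]; ring

/-! ### Typical graphs are tiny -/

theorem card_densePairs_le {n : ℕ} (G : SimpleGraph (Fin n)) (j e : ℕ) :
    (densePairs G j e).card ≤ n ^ j * 2 ^ (j ^ 2) := by
  classical
  have h : (densePairs G j e).card ≤
      ((Finset.univ.powersetCard j).sigma fun S : Finset (Fin n) => S.sym2.powerset).card := by
    refine Finset.card_le_card_of_injOn (fun q => ⟨q.1, q.2⟩) ?_ ?_
    · intro q hq
      obtain ⟨h1, -, h3, -⟩ := mem_densePairs.1 hq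
      simp only [Finset.coe_sigma, Set.mem_sigma_iff, Finset.mem_coe, Finset.mem_powersetCard,
        Finset.mem_powerset]
      exact ⟨⟨Finset.subset_univ _, h1⟩, h3⟩
    · rintro ⟨a, b⟩ _ ⟨a', b'⟩ _ h
      simpa using h
  refine h.trans ?_
  rw [Finset.card_sigma]
  calc ∑ S ∈ (Finset.univ : Finset (Fin n)).powersetCard j, S.sym2.powerset.card
      ≤ ∑ S ∈ (Finset.univ : Finset (Fin n)).powersetCard j, 2 ^ (j ^ 2) := by
        refine Finset.sum_le_sum fun S hS => ?_
        rw [Finset.card_powerset, Finset.card_sym2, (Finset.mem_powersetCard.1 hS).2]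
        refine Nat.pow_le_pow_right (by norm_num) ?_
        rw [Nat.choose_two_right, Nat.add_sub_cancel]
        refine Nat.div_le_of_le_mul ?_
        nlinarith [Nat.le_self_pow (two_ne_zero) j]
    _ = n.choose j * 2 ^ (j ^ 2) := by simp
    _ ≤ n ^ j * 2 ^ (j ^ 2) := Nat.mul_le_mul_right _ (Nat.choose_le_pow n j)

/-- The properties of a random graph that force it to be tiny. -/
def IsTypical (d : ℝ) {n : ℕ} (G : SimpleGraph (Fin n)) : Prop :=
  (∀ j : ℕ, Real.log n < j → j ≤ n → ((densePairs G j j).card : ℝ) ≤ Real.exp (d + 3) ^ j) ∧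
  (∀ j : ℕ, (1000 : ℝ) ^ (10 * (d + 1)) ≤ j → (j : ℝ) ≤ lnSq n → ∀ q ∈ densePairs G j 0,
    (q.2.card : ℝ) ≤ (j : ℝ) - 1 + j / Real.log j)

theorem IsTypical.unlabeledSubgraphs_subset {d : ℝ} {n : ℕ} {G : SimpleGraph (Fin n)}
    (hG : IsTypical d G) {k : ℕ} (hk : (k : ℝ) ≤ lnSq n) :
    unlabeledSubgraphs G k ⊆ sparseClass d k := by
  classical
  rintro U ⟨H, K, ⟨φ⟩, rfl⟩ G' hG' j hj hjk H' hH'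
  obtain ⟨ψ⟩ : Nonempty (G' ≃g K) := Quotient.exact hG'
  let f : G' →g G := H.hom.comp (φ.symm.toHom.comp ψ.toHom)
  have hf : Function.Injective f :=
    Subtype.val_injective.comp (φ.symm.injective.comp ψ.injective)
  have hjr : (j : ℝ) ≤ k := by exact_mod_cast hjk
  have h := hG.2 j hj (hjr.trans hk)
    (H'.verts.toFinset.image f, H'.edgeSet.toFinset.image (Sym2.map f)) (by
      refine mem_densePairs.2 ⟨?_, ?_, ?_, Nat.zero_le _⟩
      · rw [Finset.card_image_of_injective _ hf, ← Set.ncard_eq_toFinset_card', hH']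
      · intro x hx
        obtain ⟨y, hy, rfl⟩ := Finset.mem_image.1 hx
        exact f.map_mem_edgeSet (H'.edgeSet_subset (Set.mem_toFinset.1 hy))
      · intro x hx
        obtain ⟨y, hy, rfl⟩ := Finset.mem_image.1 hx
        rw [Finset.sym2_image]
        refine Finset.mem_image_of_mem _ (Finset.mem_sym2_iff.2 fun v hv => ?_)
        exact Set.mem_toFinset.2 (H'.mem_verts_of_mem_edge (Set.mem_toFinset.1 hy) hv))
  rwa [Finset.card_image_of_injective _ (Sym2.map.injective hf),
    ← Set.ncard_eq_toFinset_card'] at h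

theorem IsTypical.numUnlabeledSubgraphs_le {d : ℝ} (hd : 0 ≤ d) {n : ℕ} (hn : 1 ≤ n)
    {G : SimpleGraph (Fin n)} (hG : IsTypical d G) {k : ℕ} (hk : lnSq n < k) (hkn : k ≤ n) :
    (numUnlabeledSubgraphs G k : ℝ) ≤ (32 * Real.exp (d + 3)) ^ k := by
  have hn' : (0 : ℝ) < n := by exact_mod_cast hn
  have hL : 0 ≤ Real.log n := Real.log_nonneg (by exact_mod_cast hn)
  have hA : 1 ≤ Real.exp (d + 3) := Real.one_le_exp (by linarith)
  have hdp : ∀ i ∈ Finset.range (k + 1),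
      ((densePairs G i i).card : ℝ) ≤ Real.exp (d + 3) ^ k := by
    intro i hi
    have hik : i ≤ k := Nat.lt_succ_iff.1 (Finset.mem_range.1 hi)
    rcases lt_or_ge (Real.log n) i with h | h
    · exact (hG.1 i h (hik.trans hkn)).trans (pow_le_pow_right₀ hA hik)
    · have h1 : ((densePairs G i i).card : ℝ) ≤ (n : ℝ) ^ i * 2 ^ (i ^ 2) := by
        exact_mod_cast card_densePairs_le G i i
      have h2 : (n : ℝ) ^ i = Real.exp (i * Real.log n) := by
        rw [Real.exp_nat_mul, Real.exp_log hn']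
      have h3 : (2 : ℝ) ^ (i ^ 2) ≤ Real.exp ((i : ℝ) ^ 2) := by
        have : (2 : ℝ) ≤ Real.exp 1 := by linarith [Real.add_one_le_exp 1]
        calc (2 : ℝ) ^ (i ^ 2) ≤ Real.exp 1 ^ (i ^ 2) := pow_le_pow_left₀ (by norm_num) this _
          _ = _ := by rw [← Real.exp_nat_mul]; simp
      refine h1.trans ?_
      rw [h2]
      refine (mul_le_mul_of_nonneg_left h3 (by positivity)).trans ?_
      rw [← Real.exp_add, ← Real.exp_nat_mul, Real.exp_le_exp]
      -- Since `i ≤ ln n`, the exponent `i ln n + i²` is at most `2 ln² n < 2k`.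
      unfold lnSq at hk
      nlinarith [mul_le_mul h h (Nat.cast_nonneg i) hL, mul_le_mul_of_nonneg_right h hL,
        mul_nonneg hd (Nat.cast_nonneg (α := ℝ) k)]
  have h1 : (numUnlabeledSubgraphs G k : ℝ) ≤
      16 ^ k * ∑ i ∈ Finset.range (k + 1), ((densePairs G i i).card : ℝ) := by
    exact_mod_cast _root_.numUnlabeledSubgraphs_le G k
  -- The number of possible core sizes is absorbed by doubling 16 to 32.
  have h2 : ((k : ℝ) + 1) ≤ 2 ^ k := by exact_mod_cast Nat.lt_two_pow_self
  calc (numUnlabeledSubgraphs G k : ℝ)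
      ≤ 16 ^ k * ∑ i ∈ Finset.range (k + 1), Real.exp (d + 3) ^ k :=
        h1.trans (mul_le_mul_of_nonneg_left (Finset.sum_le_sum hdp) (by positivity))
    _ = 16 ^ k * ((k + 1) * Real.exp (d + 3) ^ k) := by simp
    _ ≤ 16 ^ k * (2 ^ k * Real.exp (d + 3) ^ k) := by gcongr
    _ = (32 * Real.exp (d + 3)) ^ k := by rw [← mul_pow, ← mul_pow, ← mul_assoc]; norm_num

theorem IsTypical.isMonotoneTiny {d : ℝ} (hd : 0 ≤ d) {n : ℕ} (hn : 1 ≤ n)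
    {G : SimpleGraph (Fin n)} (hG : IsTypical d G) :
    IsMonotoneTiny (32 * Real.exp (d + 3)) (sparseClass d) lnSq G :=
  ⟨fun _ _ hk => hG.unlabeledSubgraphs_subset hk,
    fun _ hk hkn => hG.numUnlabeledSubgraphs_le hd hn hk hkn⟩

/-! ### Random graphs are typical -/

theorem isTypical_of_ncard_edgeSet_le_one {d : ℝ} (hd : 0 ≤ d) {n : ℕ} (hn : 1 ≤ n)
    {G : SimpleGraph (Fin n)} (hG : G.edgeSet.ncard ≤ 1) : IsTypical d G := by
  classical
  have hF (F : Finset (Sym2 (Fin n))) (h : ∀ x ∈ F, x ∈ G.edgeSet) : F.card ≤ 1 := by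
    rw [← Set.ncard_coe_finset]
    exact (Set.ncard_le_ncard (fun x hx => h x hx) (Set.toFinite _)).trans hG
  refine ⟨fun j hj _ => ?_, fun j hj _ q hq => ?_⟩
  · have hj0 : 0 < j := by
      have : (0 : ℝ) < j := (Real.log_nonneg (by exact_mod_cast hn)).trans_lt hj
      exact_mod_cast this
    have : densePairs G j j = ∅ := by
      refine Finset.eq_empty_of_forall_notMem fun q hq => ?_
      obtain ⟨h1, h2, h3, h4⟩ := mem_densePairs.1 hq
      have h5 := hF q.2 h2
      obtain ⟨x, hx⟩ := Finset.card_pos.1 (hj0.trans_le h4)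
      obtain ⟨v, hv⟩ := Finset.card_eq_one.1 (show q.1.card = 1 by omega)
      have hx' := h3 hx
      refine G.not_isDiag_of_mem_edgeSet (h2 x hx) ?_
      rw [hv] at hx'
      obtain rfl : x = Sym2.diag v := by simpa using hx'
      exact Sym2.diag_isDiag v
    rw [this, Finset.card_empty, Nat.cast_zero]
    positivity
  · have h1 : (q.2.card : ℝ) ≤ 1 := by exact_mod_cast hF q.2 (mem_densePairs.1 hq).2.1
    have h2 : (2 : ℝ) ≤ j := by
      refine le_trans ?_ hj
      calc (2 : ℝ) ≤ 1000 ^ (1 : ℝ) := by norm_num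
        _ ≤ _ := Real.rpow_le_rpow_of_exponent_le (by norm_num) (by linarith)
    have h3 : 0 ≤ (j : ℝ) / Real.log j :=
      div_nonneg (by positivity) (Real.log_nonneg (by linarith))
    linarith

/-- With `a = d + 1`, `s = √j` and `L = ln n`, the lower bound on `j` makes `j / ln j ≥ 8 a s`, and
`s ≤ L`. Hence `a j = a s · s ≤ (x/2 - 2) L`. Since `j/n ≤ exp (-L/2)`, the total exponent is at
most `-2L`. -/
theorem exp_mul_div_pow_le {d : ℝ} (hd : 0 ≤ d) {n j x : ℕ} (hn : 1 ≤ n)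
    (hj : (1000 : ℝ) ^ (10 * (d + 1)) ≤ j) (hjn : (j : ℝ) ≤ lnSq n)
    (hx : (j : ℝ) / Real.log j - 1 ≤ x) :
    (j : ℝ) ≤ n ∧ Real.exp ((d + 1) * j) * ((j : ℝ) / n) ^ x ≤ ((n : ℝ) ^ 2)⁻¹ := by
  set a := d + 1 with ha
  set L := Real.log n with hL
  have hn' : (0 : ℝ) < n := by exact_mod_cast hn
  have hL0 : 0 ≤ L := Real.log_nonneg (by exact_mod_cast hn)
  have hnL : (n : ℝ) = Real.exp L := (Real.exp_log hn').symm
  set q : ℝ := 1000 ^ a with hq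
  have hqa : 999 * a ≤ q := by
    have := one_add_mul_self_le_rpow_one_add (s := 999) (by norm_num) (p := a) (by linarith)
    rw [show (1 : ℝ) + 999 = 1000 by norm_num] at this
    linarith
  have hqj : q ^ 10 ≤ j := by
    refine le_trans (le_of_eq ?_) hj
    rw [mul_comm, Real.rpow_mul (by norm_num), ← hq]
    exact_mod_cast (Real.rpow_natCast q 10).symm
  set s := Real.sqrt j with hs
  have hsj : s ^ 2 = j := Real.sq_sqrt (by positivity)
  have hqs : q ^ 5 ≤ s := Real.le_sqrt_of_sq_le (by rw [← pow_mul]; exact hqj)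
  have hsL : s ≤ L := Real.sqrt_le_iff.2 ⟨hL0, hjn⟩
  have hq1 : 999 ≤ q := by nlinarith
  have hqq : q ^ 2 ≤ q ^ 5 := pow_le_pow_right₀ (by linarith) (by norm_num)
  have hsa : 1024 * a ^ 2 ≤ s := by nlinarith
  have hs0 : 1024 ≤ s := by nlinarith
  have hlogs : Real.log s ≤ s / (16 * a) := by
    set r := Real.sqrt s with hr
    have hrs : r ^ 2 = s := Real.sq_sqrt (by linarith)
    have hra : 32 * a ≤ r := Real.le_sqrt_of_sq_le (by nlinarith)
    have hr0 : 0 < r := by nlinarith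
    have h1 : Real.log s = 2 * Real.log r := by rw [← hrs, Real.log_pow]; norm_num
    have h2 := Real.log_le_sub_one_of_pos hr0
    rw [le_div_iff₀ (by linarith), h1]
    nlinarith
  have hlogs0 : 0 < Real.log s := Real.log_pos (by linarith)
  have hjl : 8 * a * s ≤ (j : ℝ) / Real.log j := by
    rw [← hsj, Real.log_pow, le_div_iff₀ (by positivity)]
    rw [le_div_iff₀ (by linarith)] at hlogs
    push_cast
    nlinarith
  -- The degree 4 term of the exponential series is `L⁴/384`, and `L ≥ 1024`.
  have hL2 : L ^ 2 ≤ Real.exp (L / 2) := by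
    have h := Real.pow_div_factorial_le_exp (L / 2) (by linarith) 4
    refine le_trans ?_ h
    have h4 : ((Nat.factorial 4 : ℕ) : ℝ) = 24 := by norm_num [Nat.factorial]
    rw [h4, le_div_iff₀ (by norm_num)]
    have : 0 ≤ L ^ 2 * (L ^ 2 - 384) := mul_nonneg (by positivity) (by nlinarith)
    nlinarith
  have hjn2 : (j : ℝ) / n ≤ Real.exp (-(L / 2)) := by
    rw [div_le_iff₀ hn', hnL, ← Real.exp_add]
    refine (hjn.trans hL2).trans (le_of_eq ?_)
    congr 1; ring
  constructor
  · refine (hjn.trans hL2).trans ?_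
    rw [hnL, Real.exp_le_exp]; linarith
  · calc Real.exp (a * j) * ((j : ℝ) / n) ^ x
        ≤ Real.exp (a * j) * Real.exp (-(L / 2)) ^ x := by gcongr
      _ = Real.exp (a * j + x * -(L / 2)) := by rw [← Real.exp_nat_mul, ← Real.exp_add]
      _ ≤ Real.exp (-(2 * L)) := by
          rw [Real.exp_le_exp]
          have h0 : 1 ≤ a * s := one_le_mul_of_one_le_of_one_le (by linarith) (by linarith)
          have h1 : a * s ≤ (x : ℝ) / 2 - 2 := by linarith
          have h2 : (a * s) * s ≤ ((x : ℝ) / 2 - 2) * L :=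
            mul_le_mul h1 hsL (by linarith) (by linarith)
          rw [← hsj]
          linarith
      _ = ((n : ℝ) ^ 2)⁻¹ := by
          rw [Real.exp_neg, hnL, ← Real.exp_nat_mul]; norm_num

theorem card_filter_le_of_sum_le {α : Type*} (s : Finset α) (f : α → ℕ) (P : α → Prop)
    [DecidablePred P] {b B : ℝ} (hb : 0 < b) (hP : ∀ x ∈ s, P x → b ≤ f x)
    (hB : ∑ x ∈ s, (f x : ℝ) ≤ B) : ((s.filter P).card : ℝ) ≤ B / b := by
  rw [le_div_iff₀ hb]
  calc ((s.filter P).card : ℝ) * b = ∑ x ∈ s.filter P, b := by simp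
    _ ≤ ∑ x ∈ s.filter P, (f x : ℝ) := by
        refine Finset.sum_le_sum fun x hx => ?_
        rw [Finset.mem_filter] at hx
        exact hP x hx.1 hx.2
    _ ≤ ∑ x ∈ s, (f x : ℝ) :=
        Finset.sum_le_sum_of_subset_of_nonneg (Finset.filter_subset _ _) fun _ _ _ => by positivity
    _ ≤ B := hB

open Classical in
theorem card_not_isTypical_le {n m : ℕ} {d : ℝ} (hd : 0 ≤ d) (hn : 1 ≤ n)
    (hN0 : 0 < n.choose 2) (hm : m ≤ n.choose 2)
    (hp : (m : ℝ) / (n.choose 2 : ℕ) ≤ 2 * d / n) :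
    (((graphsWithEdges n m).filter fun G => ¬ IsTypical d G).card : ℝ) ≤
      (graphsWithEdges n m).card * (2 / n) := by
  set W : ℝ := ((graphsWithEdges n m).card : ℝ) with hW
  have hW0 : 0 ≤ W := by positivity
  have hn' : (0 : ℝ) < n := by exact_mod_cast hn
  let A (j : ℕ) (G : SimpleGraph (Fin n)) : Prop :=
    Real.log n < j ∧ Real.exp (d + 3) ^ j < ((densePairs G j j).card : ℝ)
  let B (j : ℕ) (G : SimpleGraph (Fin n)) : Prop :=
    (1000 : ℝ) ^ (10 * (d + 1)) ≤ j ∧ (j : ℝ) ≤ lnSq n ∧ ∃ q ∈ densePairs G j 0,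
      (j : ℝ) - 1 + j / Real.log j < (q.2.card : ℝ)
  have hA (j : ℕ) (hj : 1 ≤ j) (hjn : j ≤ n) :
      (((graphsWithEdges n m).filter (A j)).card : ℝ) ≤ W * ((n : ℝ) ^ 2)⁻¹ := by
    by_cases hlog : Real.log n < j
    · have h := card_filter_le_of_sum_le (graphsWithEdges n m) (fun G => (densePairs G j j).card)
        (A j) (b := Real.exp (d + 3) ^ j) (by positivity) (fun G _ h => h.2.le)
        (sum_card_densePairs_le hd hN0 hm hp j j hj hjn le_rfl)
      refine h.trans ?_
      rw [Nat.sub_self, pow_zero, mul_one, mul_div_assoc]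
      refine mul_le_mul_of_nonneg_left ?_ hW0
      rw [← Real.exp_nat_mul, ← Real.exp_sub, ← Real.exp_log hn', ← Real.exp_nat_mul,
        ← Real.exp_neg, Real.exp_le_exp]
      push_cast
      -- Markov's inequality leaves `exp (-2j)`, and `j > ln n`.
      nlinarith
    · rw [Finset.filter_false_of_mem fun G _ h => hlog h.1, Finset.card_empty, Nat.cast_zero]
      positivity
  have hB (j : ℕ) : (((graphsWithEdges n m).filter (B j)).card : ℝ) ≤ W * ((n : ℝ) ^ 2)⁻¹ := by
    by_cases hj : (1000 : ℝ) ^ (10 * (d + 1)) ≤ j ∧ (j : ℝ) ≤ lnSq n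
    · have hj1 : (1 : ℝ) < j := lt_of_lt_of_le (Real.one_lt_rpow (by norm_num) (by linarith)) hj.1
      have hjl : 0 < (j : ℝ) / Real.log j := div_pos (by linarith) (Real.log_pos hj1)
      -- The least integer above the permitted number of edges; it is at least `j` because `j / ln j
      -- > 0`.
      set e := ⌊(j : ℝ) - 1 + j / Real.log j⌋₊ + 1 with he
      have he1 : (j : ℝ) - 1 + j / Real.log j < e := by
        rw [he]; push_cast; exact Nat.lt_floor_add_one _
      have hje : j ≤ e := by
        have : (j : ℝ) < e + 1 := by linarith
        exact Nat.lt_succ_iff.1 (by exact_mod_cast this)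
      obtain ⟨h1, h2⟩ := exp_mul_div_pow_le (x := e - j) hd hn hj.1 hj.2 (by
        rw [Nat.cast_sub hje]; linarith)
      have h := card_filter_le_of_sum_le (graphsWithEdges n m) (fun G => (densePairs G j e).card)
        (B j) (b := 1) one_pos (fun G _ h => by
          obtain ⟨-, -, q, hq, hqe⟩ := h
          obtain ⟨q1, q2, q3, -⟩ := mem_densePairs.1 hq
          have h5 : e ≤ q.2.card := by
            rw [he]
            exact Nat.succ_le_of_lt ((Nat.floor_lt (by linarith)).2 hqe)
          have h6 : 0 < (densePairs G j e).card :=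
            Finset.card_pos.2 ⟨q, mem_densePairs.2 ⟨q1, q2, q3, h5⟩⟩
          exact_mod_cast h6)
        (sum_card_densePairs_le hd hN0 hm hp j e (by exact_mod_cast (by linarith : (0 : ℝ) < j))
          (by exact_mod_cast h1) hje)
      rw [div_one] at h
      exact h.trans (mul_le_mul_of_nonneg_left h2 hW0)
    · rw [Finset.filter_false_of_mem fun G _ h => hj ⟨h.1, h.2.1⟩, Finset.card_empty,
        Nat.cast_zero]
      positivity
  have hsub : (graphsWithEdges n m).filter (fun G => ¬ IsTypical d G) ⊆
      (Finset.Icc 1 n).biUnion fun j =>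
        (graphsWithEdges n m).filter (A j) ∪ (graphsWithEdges n m).filter (B j) := by
    intro G hG
    obtain ⟨hGm, hG⟩ := Finset.mem_filter.1 hG
    simp only [Finset.mem_biUnion, Finset.mem_union, Finset.mem_filter, Finset.mem_Icc]
    rw [IsTypical, not_and_or] at hG
    push Not at hG
    rcases hG with ⟨j, hj, hjn, h⟩ | ⟨j, hj, hjn, q, hq, h⟩
    · have : (0 : ℝ) < j := (Real.log_nonneg (by exact_mod_cast hn)).trans_lt hj
      exact ⟨j, ⟨by exact_mod_cast this, hjn⟩, Or.inl ⟨hGm, hj, h⟩⟩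
    · have hj1 : (1 : ℝ) < j := lt_of_lt_of_le (Real.one_lt_rpow (by norm_num) (by linarith)) hj
      -- Any admissible `x` will do: only the conclusion `j ≤ n` is needed here.
      obtain ⟨x, hx⟩ := exists_nat_ge ((j : ℝ) / Real.log j - 1)
      have h1 := (exp_mul_div_pow_le hd hn hj hjn hx).1
      exact ⟨j, ⟨by exact_mod_cast hj1.le, by exact_mod_cast h1⟩, Or.inr ⟨hGm, hj, hjn, q, hq, h⟩⟩
  calc (((graphsWithEdges n m).filter fun G => ¬ IsTypical d G).card : ℝ)
      ≤ ∑ j ∈ Finset.Icc 1 n, ((((graphsWithEdges n m).filter (A j)).card : ℝ) +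
          ((graphsWithEdges n m).filter (B j)).card) := by
        have h1 := (Finset.card_le_card hsub).trans Finset.card_biUnion_le
        have h2 := h1.trans (Finset.sum_le_sum fun j _ => Finset.card_union_le _ _)
        exact_mod_cast h2
    _ ≤ ∑ j ∈ Finset.Icc 1 n, (W * ((n : ℝ) ^ 2)⁻¹ + W * ((n : ℝ) ^ 2)⁻¹) := by
        refine Finset.sum_le_sum fun j hj => add_le_add ?_ (hB j)
        exact hA j (Finset.mem_Icc.1 hj).1 (Finset.mem_Icc.1 hj).2
    _ = W * (2 / n) := by
        simp only [Finset.sum_const, Nat.card_Icc, Nat.add_sub_cancel, nsmul_eq_mul]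
        field_simp; ring

theorem toReal_gnm_toOuterMeasure_le {n m : ℕ} (hm : m ≤ n.choose 2)
    {s : Set (SimpleGraph (Fin n))} (Q : SimpleGraph (Fin n) → Prop) [DecidablePred Q]
    (hQ : ∀ G ∈ s, Q G) :
    ((gnm n m hm).toOuterMeasure s).toReal ≤
      (((graphsWithEdges n m).filter Q).card : ℝ) / (graphsWithEdges n m).card := by
  classical
  rw [gnm, PMF.toOuterMeasure_uniformOfFinset_apply, ENNReal.toReal_div]
  simp only [ENNReal.toReal_natCast]
  gcongr with G hG
  exact hQ G

theorem theorem3p1 (d : ℝ) (hd : 0 ≤ d) :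
    ∃ c : ℝ, 0 < c ∧ ∀ n : ℕ, 1 ≤ n →
      ∀ hm : ⌈d * ((n : ℝ) - 1) / 2⌉₊ ≤ n.choose 2,
        ((gnm n ⌈d * ((n : ℝ) - 1) / 2⌉₊ hm).toOuterMeasure
            {G | ¬ IsMonotoneTiny c (sparseClass d) lnSq G}).toReal
          ≤ 200 * Real.sqrt (d / (n : ℝ)) ∧
        (0 < d →
          ((gnm n ⌈d * ((n : ℝ) - 1) / 2⌉₊ hm).toOuterMeasure
              {G | ¬ IsMonotoneTiny c (sparseClass d) lnSq G}).toReal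
            < 200 * Real.sqrt (d / (n : ℝ))) := by
  classical
  refine ⟨32 * Real.exp (d + 3), by positivity, fun n hn hm => ?_⟩
  have hn' : (0 : ℝ) < n := by exact_mod_cast hn
  have hceil := Nat.ceil_lt_add_one (a := d * ((n : ℝ) - 1) / 2) (by
    have : (1 : ℝ) ≤ n := by exact_mod_cast hn
    have := mul_nonneg hd (sub_nonneg.2 this)
    linarith)
  have hceil2 := Nat.lt_ceil (a := d * ((n : ℝ) - 1) / 2) (n := 1)
  set m := ⌈d * ((n : ℝ) - 1) / 2⌉₊
  have hW : 0 < ((graphsWithEdges n m).card : ℝ) := by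
    exact_mod_cast Finset.card_pos.2 (graphsWithEdges_nonempty hm)
  have hbad := toReal_gnm_toOuterMeasure_le hm (fun G => ¬ IsTypical d G)
    (s := {G | ¬ IsMonotoneTiny (32 * Real.exp (d + 3)) (sparseClass d) lnSq G})
    fun G hG hT => hG (hT.isMonotoneTiny hd hn)
  rcases le_or_gt m 1 with hm1 | hm1
  · rw [Finset.filter_false_of_mem (s := graphsWithEdges n m), Finset.card_empty, Nat.cast_zero,
      zero_div] at hbad
    · exact ⟨hbad.trans (by positivity), fun hd0 => hbad.trans_lt (by positivity)⟩
    · intro G hG hT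
      rw [graphsWithEdges, Finset.mem_filter] at hG
      exact hT (isTypical_of_ncard_edgeSet_le_one hd hn (hG.2.trans_le hm1))
  · have hdn : 1 < d * ((n : ℝ) - 1) / 2 := by exact_mod_cast hceil2.1 hm1
    have hn1 : (1 : ℝ) < n := by
      by_contra h
      nlinarith
    have hN : ((n.choose 2 : ℕ) : ℝ) = n * (n - 1) / 2 := Nat.cast_choose_two ℝ n
    -- Here `d(n-1)/2 > 1`, so rounding up at most doubles it: `m < d(n-1)`.
    have hp : (m : ℝ) / (n.choose 2 : ℕ) ≤ 2 * d / n := by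
      have : 0 < (n : ℝ) - 1 := by linarith
      rw [hN, div_le_div_iff₀ (by positivity) hn']
      nlinarith
    have h1 := card_not_isTypical_le hd hn (by omega) hm hp
    have h2 := hbad.trans ((div_le_iff₀' hW).2 h1)
    have h3 : 2 / (n : ℝ) < 200 * Real.sqrt (d / n) := by
      have : 1 / (100 * (n : ℝ)) < Real.sqrt (d / n) := by
        refine Real.lt_sqrt_of_sq_lt ?_
        rw [div_pow, div_lt_div_iff₀ (by positivity) hn']
        nlinarith
      calc 2 / (n : ℝ) = 200 * (1 / (100 * (n : ℝ))) := by field_simp; norm_num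
        _ < _ := by linarith
    exact ⟨(h2.trans_lt h3).le, fun _ => h2.trans_lt h3⟩
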